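/- Let $n\ge 2$, let $\mathbb{H}^n=\{x\in\mathbb{R}^n: x_n>0\}$, let $e_n$ be the $n$-th standard unit vector and let $B^n(a,\rho)$ denote the open Euclidean ball. For $x,y\in\mathbb{H}^n$ let $v(x,y)=\sup\{\measuredangle(x,z,y): z\in\partial\mathbb{H}^n\}$, where $\measuredangle(x,z,y)\in[0,\pi]$ is the angle at $z$ between the segments $[z,x]$ and $[z,y]$, and let $B_v(x,r)=\{y\in\mathbb{H}^n: v(x,y)<r\}$. Let $x\in\mathbb{H}^n$. For every $r\in(0,\pi/2)$, $$B^n\big(x+(\sec^2 r-1)x_n e_n,\ x_n\tan r\big)\subset B_v(x,r)\subset B^n\Big(x+(2x_n\tan^2 r)e_n,\ 2x_n\frac{\tan r}{\cos r}\Big),$$ and these Euclidean balls are the best possible: among all Euclidean balls (with arbitrary centres) contained in $B_v(x,r)$, the first is the unique one of largest radius, and among all Euclidean balls containing $B_v(x,r)$, the second is the unique one of smallest radius. Moreover, $$B_v(x,r)\subset B^n\Big(x,\ 2x_n\Big(\frac{\tan r}{\cos r}+\tan^2 r\Big)\Big)\quad\text{for every } r\in(0,\pi/2),$$ $$B^n(x,\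 x_n\sin r)\subset B_v(x,r)\quad\text{for every } r\in(0,\pi/2].$$ -/

import Mathlib

/-- The upper half space of dimension `d + 1`: all points of Euclidean space whose last coordinate
is positive. -/
def upperHalfSpace (d : ℕ) : Set (EuclideanSpace ℝ (Fin (d + 1))) :=
  {x | 0 < x (Fin.last d)}

/-- The visual angle metric `v_G(x, y) = sup {∡(x, z, y) : z ∈ ∂G}`; the angle at `z` is the
unoriented angle, with values in `[0, π]`, so the supremum is over a bounded set. -/
noncomputable def visualAngle {d : ℕ} (G : Set (EuclideanSpace ℝ (Fin (d + 1))))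
    (x y : EuclideanSpace ℝ (Fin (d + 1))) : ℝ :=
  sSup {θ : ℝ | ∃ z ∈ frontier G, θ = EuclideanGeometry.angle x z y}

/-- The ball `B_v(x, r) = {y ∈ G : v_G(x, y) < r}` of the visual angle metric of `G`. -/
def visualAngleBall {d : ℕ} (G : Set (EuclideanSpace ℝ (Fin (d + 1))))
    (x : EuclideanSpace ℝ (Fin (d + 1))) (r : ℝ) : Set (EuclideanSpace ℝ (Fin (d + 1))) :=
  {y | y ∈ G ∧ visualAngle G x y < r}

/-- The last standard unit vector. -/
noncomputable def lastUnitVec (d : ℕ) : EuclideanSpace ℝ (Fin (d + 1)) :=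
  EuclideanSpace.single (Fin.last d) (1 : ℝ)

/-- The centre `x + (sec² r - 1) xₙ eₙ` of the inner ball. -/
noncomputable def innerCenter {d : ℕ} (x : EuclideanSpace ℝ (Fin (d + 1))) (r : ℝ) :
    EuclideanSpace ℝ (Fin (d + 1)) :=
  x + ((1 / Real.cos r ^ 2 - 1) * x (Fin.last d)) • lastUnitVec d

/-- The centre `x + (2 xₙ tan² r) eₙ` of the outer ball. -/
noncomputable def outerCenter {d : ℕ} (x : EuclideanSpace ℝ (Fin (d + 1))) (r : ℝ) :
    EuclideanSpace ℝ (Fin (d + 1)) :=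
  x + (2 * x (Fin.last d) * Real.tan r ^ 2) • lastUnitVec d

/-!
Write `p = xₙ`, `q = yₙ` and let `t` be the horizontal distance of `x` and `y`. The visual angle
ball has a closed form (`mem_visualAngleBall_iff`): for `0 < r < π`, a point `y` of the half space
lies in `B_v(x, r)` if and only if `(p + q) cos r + t sin r < 2 √(p q)`.

The reason is that the angle `θ` at any boundary point satisfies
`(p + q) cos θ + t sin θ ≥ 2 √(p q)`, by the inequalities of Cauchy-Schwarz and of the arithmetic
and geometric means (`two_sqrt_le_of_boundary`), with equality at the point where a circle through
`x` and `y` touches the boundary (`exists_boundary_eq_two_sqrt`). The left side is a sinusoid in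
`θ` whose value at `0` is `p + q ≥ 2 √(p q)`, so by concavity (`lt_sinusoid_of_le`) it is
below `2 √(p q)` exactly for the `θ` beyond the largest angle. Strictness survives the
supremum because the inequality is open in `r`.

With the closed form, the inclusions are inequalities in `p`, `q`, `t`. In terms of
`E = cos r √q - √p` the ball is `cos r sin r t < p sin² r - E²`, which shows that its horizontal
radius is `p tan r`, approached only at the height `q = p / cos² r` of the inner centre. The outer
ball is the hyperbolic ball with the same vertical extent as `B_v(x, r)`. Both optimality claims
then follow from the parallelogram law, applied to two opposite displacements of a centre:
horizontal ones for the inner ball (`innerBall_optimal`), vertical ones for the outer ball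
(`outerBall_optimal`).
-/

open Real InnerProductGeometry

variable {d : ℕ}

/-! ### Horizontal and vertical components -/

/-- The horizontal part of a vector: its orthogonal projection to the boundary hyperplane. -/
noncomputable def horizontalPart (y : EuclideanSpace ℝ (Fin (d + 1))) :
    EuclideanSpace ℝ (Fin (d + 1)) :=
  y - y (Fin.last d) • lastUnitVec d

@[simp] lemma lastUnitVec_last : lastUnitVec d (Fin.last d) = 1 := by
  simp [lastUnitVec]

lemma inner_lastUnitVec (y : EuclideanSpace ℝ (Fin (d + 1))) :
    inner ℝ y (lastUnitVec d) = y (Fin.last d) := by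
  simp [lastUnitVec, EuclideanSpace.inner_single_right]

lemma norm_lastUnitVec : ‖lastUnitVec d‖ = 1 := by
  simp [lastUnitVec]

lemma horizontalPart_add (y z : EuclideanSpace ℝ (Fin (d + 1))) :
    horizontalPart (y + z) = horizontalPart y + horizontalPart z := by
  simp only [horizontalPart, PiLp.add_apply]; module

lemma horizontalPart_sub (y z : EuclideanSpace ℝ (Fin (d + 1))) :
    horizontalPart (y - z) = horizontalPart y - horizontalPart z := by
  simp only [horizontalPart, PiLp.sub_apply]; module

lemma horizontalPart_smul (a : ℝ) (y : EuclideanSpace ℝ (Fin (d + 1))) :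
    horizontalPart (a • y) = a • horizontalPart y := by
  simp only [horizontalPart, PiLp.smul_apply, smul_eq_mul]; module

@[simp] lemma horizontalPart_lastUnitVec : horizontalPart (lastUnitVec d) = 0 := by
  simp [horizontalPart]

lemma horizontalPart_of_last_eq_zero {y : EuclideanSpace ℝ (Fin (d + 1))}
    (h : y (Fin.last d) = 0) : horizontalPart y = y := by
  simp [horizontalPart, h]

@[simp] lemma horizontalPart_last (y : EuclideanSpace ℝ (Fin (d + 1))) :
    horizontalPart y (Fin.last d) = 0 := by
  simp [horizontalPart]

lemma inner_eq_horizontalPart (y z : EuclideanSpace ℝ (Fin (d + 1))) :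
    inner ℝ y z = inner ℝ (horizontalPart y) (horizontalPart z)
      + y (Fin.last d) * z (Fin.last d) := by
  simp only [horizontalPart, inner_sub_left, inner_sub_right, inner_smul_left, inner_smul_right,
    inner_lastUnitVec, real_inner_comm _ (lastUnitVec d), lastUnitVec_last]
  simp

lemma norm_sq_eq_horizontalPart (y : EuclideanSpace ℝ (Fin (d + 1))) :
    ‖y‖ ^ 2 = ‖horizontalPart y‖ ^ 2 + y (Fin.last d) ^ 2 := by
  rw [← real_inner_self_eq_norm_sq, ← real_inner_self_eq_norm_sq, inner_eq_horizontalPart y y, sq]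

lemma mem_ball_iff_horizontalPart {y c : EuclideanSpace ℝ (Fin (d + 1))} {ρ : ℝ} (hρ : 0 < ρ) :
    y ∈ Metric.ball c ρ ↔
      ‖horizontalPart (y - c)‖ ^ 2 + (y (Fin.last d) - c (Fin.last d)) ^ 2 < ρ ^ 2 := by
  rw [mem_ball_iff_norm, ← sq_lt_sq₀ (norm_nonneg _) hρ.le, norm_sq_eq_horizontalPart (y - c)]
  simp

lemma frontier_upperHalfSpace :
    frontier (upperHalfSpace d) = {z | z (Fin.last d) = 0} := by
  have h := ContinuousLinearMap.frontier_preimage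
    (EuclideanSpace.proj (Fin.last d) : EuclideanSpace ℝ (Fin (d + 1)) →L[ℝ] ℝ)
    (fun a => ⟨a • lastUnitVec d, by simp⟩) (Set.Ioi 0)
  rw [frontier_Ioi] at h
  exact h

/-! ### The extremal boundary angle -/

/-- Sinusoids `A cos θ + t sin θ` are strictly concave where they are positive: if such a function
is at least `m > 0` at the ends of an interval of length less than `π`, it exceeds `m` inside. -/
lemma lt_sinusoid_of_le {A t m α β : ℝ} (hm : 0 < m) (hα : 0 < α) (hαβ : α < β) (hβ : β < π)
    (h0 : m ≤ A) (h1 : m ≤ A * cos β + t * sin β) : m < A * cos α + t * sin α := by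
  have hsβ : 0 < sin β := sin_pos_of_pos_of_lt_pi (hα.trans hαβ) hβ
  have hsα : 0 < sin α := sin_pos_of_pos_of_lt_pi hα (hαβ.trans hβ)
  have hsd : 0 < sin (β - α) := sin_pos_of_pos_of_lt_pi (by linarith) (by linarith)
  -- The value at `α` is a positive combination of the values at `0` and `β`.
  have key : (A * cos α + t * sin α) * sin β
      = A * sin (β - α) + (A * cos β + t * sin β) * sin α := by
    rw [sin_sub]; ring
  have hc : sin β < sin (β - α) + sin α := by
    have hcα : cos α < 1 := by
      rw [← cos_zero]
      exact cos_lt_cos_of_nonneg_of_le_pi le_rfl (by linarith) hα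
    have hcd : cos (β - α) < 1 := by
      rw [← cos_zero]
      exact cos_lt_cos_of_nonneg_of_le_pi le_rfl (by linarith) (by linarith)
    have h : sin β = sin (β - α) * cos α + cos (β - α) * sin α := by
      rw [← sin_add]; ring_nf
    nlinarith
  refine lt_of_mul_lt_mul_right ?_ hsβ.le
  rw [key]
  nlinarith

/-- Every boundary point `z` sees `x` and `y` under an angle `θ` with
`(xₙ + yₙ) cos θ + t sin θ ≥ 2 √(xₙ yₙ)`, where `t` is the horizontal distance of `x` and `y`. -/
lemma two_sqrt_le_of_boundary {x y z : EuclideanSpace ℝ (Fin (d + 1))}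
    (hx : 0 < x (Fin.last d)) (hy : 0 < y (Fin.last d)) (hz : z (Fin.last d) = 0) :
    2 * √(x (Fin.last d) * y (Fin.last d)) ≤
      (x (Fin.last d) + y (Fin.last d)) * cos (EuclideanGeometry.angle x z y)
        + ‖horizontalPart (x - y)‖ * sin (EuclideanGeometry.angle x z y) := by
  set p := x (Fin.last d)
  set q := y (Fin.last d)
  have hcos := cos_angle_mul_norm_mul_norm (x - z) (y - z)
  have hsin := sin_angle_mul_norm_mul_norm (x - z) (y - z)
  rw [EuclideanGeometry.angle, vsub_eq_sub, vsub_eq_sub]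
  set θ := angle (x - z) (y - z)
  have hxz : (x - z) (Fin.last d) = p := by simp [hz, p]
  have hyz : (y - z) (Fin.last d) = q := by simp [hz, q]
  have hX := norm_sq_eq_horizontalPart (x - z)
  have hY := norm_sq_eq_horizontalPart (y - z)
  have hi := inner_eq_horizontalPart (x - z) (y - z)
  rw [hxz] at hX hi
  rw [hyz] at hY hi
  have hab : horizontalPart (x - y) = horizontalPart (x - z) - horizontalPart (y - z) := by
    rw [← horizontalPart_sub]; congr 1; abel
  rw [hab]
  rw [real_inner_self_eq_norm_sq, real_inner_self_eq_norm_sq, hX, hY, hi] at hsin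
  rw [hi] at hcos
  set a := horizontalPart (x - z)
  set b := horizontalPart (y - z)
  set X := ‖x - z‖
  set Y := ‖y - z‖
  have hX0 : 0 < X := by
    refine (norm_nonneg _).lt_of_ne fun h => ?_
    have hX : X ^ 2 = ‖a‖ ^ 2 + p ^ 2 := hX
    rw [show X = 0 from h.symm] at hX
    nlinarith [sq_nonneg ‖a‖]
  have hY0 : 0 < Y := by
    refine (norm_nonneg _).lt_of_ne fun h => ?_
    have hY : Y ^ 2 = ‖b‖ ^ 2 + q ^ 2 := hY
    rw [show Y = 0 from h.symm] at hY
    nlinarith [sq_nonneg ‖b‖]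
  -- Lagrange's identity bounds the sine from below.
  have hlag : ‖q • a - p • b‖ ≤ sin θ * (X * Y) := by
    rw [hsin]
    refine Real.le_sqrt_of_sq_le ?_
    rw [@norm_sub_sq_real, norm_smul, norm_smul, inner_smul_left, inner_smul_right, mul_pow,
      mul_pow, Real.norm_eq_abs, Real.norm_eq_abs, sq_abs, sq_abs]
    have := abs_real_inner_le_norm a b
    have h2 : (inner ℝ a b) ^ 2 ≤ (‖a‖ * ‖b‖) ^ 2 := sq_le_sq' (abs_le.1 this).1 (abs_le.1 this).2
    simp only [conj_trivial]
    nlinarith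
  have hcs : inner ℝ (a - b) (q • a - p • b) ≤ ‖a - b‖ * (sin θ * (X * Y)) :=
    (real_inner_le_norm _ _).trans (by gcongr)
  have hexp : inner ℝ (a - b) (q • a - p • b)
      = q * ‖a‖ ^ 2 + p * ‖b‖ ^ 2 - (p + q) * inner ℝ a b := by
    rw [inner_sub_left, inner_sub_right, inner_sub_right, inner_smul_right, inner_smul_right,
      inner_smul_right, inner_smul_right, real_inner_self_eq_norm_sq, real_inner_self_eq_norm_sq,
      real_inner_comm a b]
    ring
  have hmain : X ^ 2 * q + Y ^ 2 * p ≤ ((p + q) * cos θ + ‖a - b‖ * sin θ) * (X * Y) := by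
    rw [hX, hY]; nlinarith
  refine le_of_mul_le_mul_right ?_ (mul_pos hX0 hY0)
  refine le_trans ?_ hmain
  rw [Real.sqrt_mul hx.le]
  nlinarith [sq_nonneg (X * √q - Y * √p), Real.sq_sqrt hx.le, Real.sq_sqrt hy.le]

lemma exists_unit_horizontal (hd : 1 ≤ d) :
    ∃ e : EuclideanSpace ℝ (Fin (d + 1)), ‖e‖ = 1 ∧ e (Fin.last d) = 0 := by
  refine ⟨EuclideanSpace.single 0 1, by simp, ?_⟩
  have : Fin.last d ≠ 0 := by
    intro h; have := congrArg Fin.val h; simp at this; omega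
  simp [this]

lemma exists_unit_smul_horizontalPart (hd : 1 ≤ d) (w : EuclideanSpace ℝ (Fin (d + 1))) :
    ∃ e : EuclideanSpace ℝ (Fin (d + 1)),
      ‖e‖ = 1 ∧ e (Fin.last d) = 0 ∧ horizontalPart w = ‖horizontalPart w‖ • e := by
  by_cases h : horizontalPart w = 0
  · obtain ⟨e, he, he'⟩ := exists_unit_horizontal hd
    exact ⟨e, he, he', by simp [h]⟩
  · refine ⟨‖horizontalPart w‖⁻¹ • horizontalPart w, ?_, ?_, ?_⟩
    · exact norm_smul_inv_norm (𝕜 := ℝ) h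
    · simp
    · rw [smul_smul, mul_inv_cancel₀ (norm_ne_zero_iff.2 h), one_smul]

/-- For `x ≠ y` the bound of `two_sqrt_le_of_boundary` is attained: at the point `z` where a circle
through `x` and `y`, in the vertical plane containing both, is tangent to the boundary. -/
lemma exists_boundary_eq_two_sqrt (hd : 1 ≤ d) {x y : EuclideanSpace ℝ (Fin (d + 1))}
    (hx : 0 < x (Fin.last d)) (hy : 0 < y (Fin.last d)) (hxy : x ≠ y) :
    ∃ z : EuclideanSpace ℝ (Fin (d + 1)), z (Fin.last d) = 0 ∧
      0 < sin (EuclideanGeometry.angle x z y) ∧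
      (x (Fin.last d) + y (Fin.last d)) * cos (EuclideanGeometry.angle x z y)
        + ‖horizontalPart (x - y)‖ * sin (EuclideanGeometry.angle x z y)
        = 2 * √(x (Fin.last d) * y (Fin.last d)) := by
  obtain ⟨e, he, he0, hex⟩ := exists_unit_smul_horizontalPart hd (x - y)
  have hD := norm_sq_eq_horizontalPart (x - y)
  have hD0 : 0 < ‖x - y‖ := norm_pos_iff.2 (sub_ne_zero.2 hxy)
  rw [PiLp.sub_apply] at hD
  set p := x (Fin.last d)
  set q := y (Fin.last d)
  set t := ‖horizontalPart (x - y)‖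
  set D := ‖x - y‖
  have ht : 0 ≤ t := norm_nonneg _
  set m := √(p * q)
  have hm : 0 < m := Real.sqrt_pos.2 (mul_pos hx hy)
  have hm2 : m ^ 2 = p * q := Real.sq_sqrt (mul_pos hx hy).le
  have hK : 0 < p * t + m * D := by positivity
  -- `u` is the horizontal distance from `x` to the point of tangency.
  obtain ⟨u, hu⟩ : ∃ u, u * (p * t + m * D) = p * (t ^ 2 + q * (q - p)) :=
    ⟨_, div_mul_cancel₀ _ hK.ne'⟩
  have hu1 : (q - p) * u + p * t = m * D := by
    refine mul_right_cancel₀ hK.ne' ?_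
    linear_combination (q - p) * hu - p * q * hD - D ^ 2 * hm2
  have hu2 : (u ^ 2 + p ^ 2) * q = ((u - t) ^ 2 + q ^ 2) * p := by
    linear_combination u * hu1 + hu
  obtain ⟨z, hz⟩ : ∃ z, z = horizontalPart x - u • e := ⟨_, rfl⟩
  have hz0 : z (Fin.last d) = 0 := by simp [hz, he0]
  have hhz : horizontalPart z = horizontalPart x - u • e :=
    (horizontalPart_of_last_eq_zero hz0).trans hz
  refine ⟨z, hz0, ?_⟩
  have ha : horizontalPart (x - z) = u • e := by
    rw [horizontalPart_sub, hhz]; abel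
  have hb : horizontalPart (y - z) = (u - t) • e := by
    rw [sub_smul, ← hex, horizontalPart_sub, horizontalPart_sub, hhz]; abel
  have hcos := cos_angle_mul_norm_mul_norm (x - z) (y - z)
  have hsin := sin_angle_mul_norm_mul_norm (x - z) (y - z)
  rw [EuclideanGeometry.angle, vsub_eq_sub, vsub_eq_sub]
  set θ := angle (x - z) (y - z)
  have hX := norm_sq_eq_horizontalPart (x - z)
  have hY := norm_sq_eq_horizontalPart (y - z)
  have hi := inner_eq_horizontalPart (x - z) (y - z)
  rw [ha, norm_smul, he, mul_one, Real.norm_eq_abs, sq_abs, PiLp.sub_apply, hz0, sub_zero] at hX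
  rw [hb, norm_smul, he, mul_one, Real.norm_eq_abs, sq_abs, PiLp.sub_apply, hz0, sub_zero] at hY
  rw [ha, hb, inner_smul_left, inner_smul_right, real_inner_self_eq_norm_sq, he, PiLp.sub_apply,
    PiLp.sub_apply, hz0, sub_zero, sub_zero, conj_trivial] at hi
  rw [real_inner_self_eq_norm_sq, real_inner_self_eq_norm_sq, hX, hY, hi] at hsin
  rw [hi] at hcos
  have hs : sin θ * (‖x - z‖ * ‖y - z‖) = m * D := by
    rw [hsin, ← Real.sqrt_sq (mul_pos hm hD0).le]
    congr 1
    rw [← hu1]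
    ring
  have hX0 : 0 < ‖x - z‖ := by
    refine (norm_nonneg _).lt_of_ne fun h => ?_
    rw [← h] at hX; nlinarith [sq_nonneg u]
  have hY0 : 0 < ‖y - z‖ := by
    refine (norm_nonneg _).lt_of_ne fun h => ?_
    rw [← h] at hY; nlinarith [sq_nonneg (u - t)]
  refine ⟨pos_of_mul_pos_left (hs ▸ mul_pos hm hD0) (by positivity), ?_⟩
  have hmXY : m * (‖x - z‖ * ‖y - z‖) = (u ^ 2 + p ^ 2) * q := by
    rw [← sq_eq_sq₀ (by positivity) (by positivity), mul_pow, mul_pow, hX, hY, hm2]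
    linear_combination (-(u ^ 2 + p ^ 2) * q) * hu2
  refine mul_right_cancel₀ (mul_pos hX0 hY0).ne' ?_
  linear_combination (p + q) * hcos + t * hs - 2 * hmXY - t * hu1 - hu2

/-! ### The visual angle ball in coordinates -/

/-- The visual angle ball in coordinates: with `t` the horizontal distance of `x` and `y`, it is
given by `(xₙ + yₙ) cos r + t sin r < 2 √(xₙ yₙ)`. -/
lemma mem_visualAngleBall_iff (hd : 1 ≤ d) {x y : EuclideanSpace ℝ (Fin (d + 1))}
    (hx : 0 < x (Fin.last d)) {r : ℝ} (hr : 0 < r) (hrπ : r < π) :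
    y ∈ visualAngleBall (upperHalfSpace d) x r ↔ 0 < y (Fin.last d) ∧
      (x (Fin.last d) + y (Fin.last d)) * cos r + ‖horizontalPart (y - x)‖ * sin r
        < 2 * √(x (Fin.last d) * y (Fin.last d)) := by
  rw [horizontalPart_sub, norm_sub_rev, ← horizontalPart_sub]
  refine and_congr_right fun hy => ?_
  replace hy : 0 < y (Fin.last d) := hy
  rw [visualAngle, frontier_upperHalfSpace]
  set S := {θ : ℝ | ∃ z ∈ {z : EuclideanSpace ℝ (Fin (d + 1)) | z (Fin.last d) = 0},
    θ = EuclideanGeometry.angle x z y} with hS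
  have hm : 0 < 2 * √(x (Fin.last d) * y (Fin.last d)) := by positivity
  have hA : 2 * √(x (Fin.last d) * y (Fin.last d)) ≤ x (Fin.last d) + y (Fin.last d) := by
    rw [Real.sqrt_mul hx.le]
    nlinarith [sq_nonneg (√(x (Fin.last d)) - √(y (Fin.last d))), Real.sq_sqrt hx.le,
      Real.sq_sqrt hy.le]
  constructor
  · intro h
    by_contra! hF
    have hxy : x ≠ y := by
      rintro rfl
      have hc : cos r < 1 := by
        rw [← cos_zero]; exact cos_lt_cos_of_nonneg_of_le_pi le_rfl hrπ.le hr
      rw [Real.sqrt_mul_self hx.le, sub_self, horizontalPart] at hF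
      simp at hF
      nlinarith
    obtain ⟨z, hz, hs, he⟩ := exists_boundary_eq_two_sqrt hd hx hy hxy
    have hlt : EuclideanGeometry.angle x z y < r := by
      refine lt_of_le_of_lt (le_csSup (s := S) ⟨π, ?_⟩ ⟨z, hz, rfl⟩) h
      rintro θ ⟨z, -, rfl⟩
      exact EuclideanGeometry.angle_le_pi _ _ _
    have h0 : 0 < EuclideanGeometry.angle x z y := by
      refine (EuclideanGeometry.angle_nonneg _ _ _).lt_of_ne fun h0 => ?_
      rw [← h0, sin_zero] at hs
      exact lt_irrefl _ hs
    exact (lt_sinusoid_of_le hm h0 hlt hrπ hA hF).ne' he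
  · intro hF
    -- The strict inequality persists for some `r' < r`, which bounds the supremum away from `r`.
    obtain ⟨r', hr'0, hr', hF'⟩ : ∃ r', 0 < r' ∧ r' < r ∧
        (x (Fin.last d) + y (Fin.last d)) * cos r' + ‖horizontalPart (x - y)‖ * sin r'
          < 2 * √(x (Fin.last d) * y (Fin.last d)) := by
      have hcont : Continuous fun s => (x (Fin.last d) + y (Fin.last d)) * cos s
          + ‖horizontalPart (x - y)‖ * sin s := by fun_prop
      have h1 : ∀ᶠ s in nhdsWithin r (Set.Iio r), (x (Fin.last d) + y (Fin.last d)) * cos s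
          + ‖horizontalPart (x - y)‖ * sin s < 2 * √(x (Fin.last d) * y (Fin.last d)) :=
        nhdsWithin_le_nhds ((hcont.tendsto r).eventually (gt_mem_nhds hF))
      have h2 : ∀ᶠ s in nhdsWithin r (Set.Iio r), 0 < s :=
        nhdsWithin_le_nhds (lt_mem_nhds hr)
      obtain ⟨s, ⟨hs1, hs2⟩, hs3⟩ :=
        ((h1.and h2).and self_mem_nhdsWithin).exists
      exact ⟨s, hs2, hs3, hs1⟩
    refine lt_of_le_of_lt (csSup_le ⟨_, 0, by simp, rfl⟩ ?_) hr'
    rintro θ ⟨z, hz, rfl⟩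
    by_contra! hlt
    have hb := two_sqrt_le_of_boundary hx hy hz
    rcases (EuclideanGeometry.angle_le_pi x z y).lt_or_eq with hπ | hπ
    · exact (lt_sinusoid_of_le hm hr'0 hlt hπ hA hb).not_gt hF'
    · rw [hπ, cos_pi, sin_pi] at hb
      linarith

/-! ### Planar inequalities -/

/-- The coordinate inequality of the visual angle ball as an inequality for `√q`. -/
lemma planar_iff {p q t c s : ℝ} (hp : 0 < p) (hq : 0 < q) (hc : 0 < c) (hcs : c ^ 2 + s ^ 2 = 1) :
    (p + q) * c + t * s < 2 * √(p * q) ↔ c * s * t < p * s ^ 2 - (c * √q - √p) ^ 2 := by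
  have h : p * s ^ 2 - (c * √q - √p) ^ 2 - c * s * t
      = c * (2 * √(p * q) - ((p + q) * c + t * s)) := by
    rw [Real.sqrt_mul hp.le]
    linear_combination p * hcs - c ^ 2 * Real.sq_sqrt hq.le - Real.sq_sqrt hp.le
  rw [← sub_pos, ← sub_pos (b := c * s * t), h, mul_pos_iff_of_pos_left hc]

/-- A point of the inner ball satisfies the inequality of the visual angle ball. -/
lemma planar_of_mem_inner {p q t c s : ℝ} (hp : 0 < p) (hc : 0 < c) (hs : 0 < s)
    (hcs : c ^ 2 + s ^ 2 = 1) (h : c ^ 4 * t ^ 2 + (c ^ 2 * q - p) ^ 2 < (p * s * c) ^ 2) :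
    0 < q ∧ (p + q) * c + t * s < 2 * √(p * q) := by
  have hs1 : s < 1 := by nlinarith
  have hc1 : c < 1 := by nlinarith
  have hq : 0 < q := by
    have h1 : (c ^ 2 * q - p) ^ 2 < (p * s * c) ^ 2 := by nlinarith [sq_nonneg (c ^ 2 * t)]
    have h2 := (abs_lt_of_sq_lt_sq' h1 (by positivity)).1
    have h3 : p * s * c < p := by nlinarith [mul_pos hp hs, mul_pos hs hc]
    exact pos_of_mul_pos_right (a := c ^ 2) (by linarith) (by positivity)
  refine ⟨hq, (planar_iff hp hq hc hcs).2 ?_⟩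
  have hP0 := Real.sqrt_pos.2 hp
  have hP := Real.sq_sqrt hp.le
  have hQ0 := Real.sqrt_pos.2 hq
  have hQ := Real.sq_sqrt hq.le
  set P := √p
  set Q := √q
  -- `E` measures the deviation of `q` from the height `p / c²` of the points of contact.
  obtain ⟨E, hE⟩ : ∃ E, E = c * Q - P := ⟨_, rfl⟩
  have hE2 : c ^ 2 * q - p = E * (E + 2 * P) := by rw [hE, ← hP, ← hQ]; ring
  rw [hE2] at h
  rw [← hE]
  have hEP : P < E + 2 * P := by nlinarith
  have hsmall : E ^ 2 < p * s ^ 2 := by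
    have h1 : (E * (E + 2 * P)) ^ 2 < (p * s * c) ^ 2 := by nlinarith [sq_nonneg (c ^ 2 * t)]
    have h2 : E ^ 2 * P ^ 2 ≤ (E * (E + 2 * P)) ^ 2 := by
      rw [mul_pow]; gcongr
    have h3 : E ^ 2 * p < p * s ^ 2 * c ^ 2 * p := by rw [hP] at h2; nlinarith
    have h4 := lt_of_mul_lt_mul_right h3 hp.le
    have h5 : p * s ^ 2 * c ^ 2 ≤ p * s ^ 2 * 1 := by gcongr; nlinarith
    linarith
  refine lt_of_pow_lt_pow_left₀ 2 (by linarith) ?_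
  refine lt_of_mul_lt_mul_left ?_ (sq_nonneg c)
  -- What remains is `E² (c² (E² - 2 p s²) + s² (E + 2 P)²) ≥ 0`; as `p = P²`, the second
  -- factor is `(E + 2 P s²)² + 2 p s² c²`.
  have hfin : 0 ≤ E ^ 2 * ((E + 2 * P * s ^ 2) ^ 2 + 2 * p * s ^ 2 * c ^ 2) := by positivity
  have hid : c ^ 2 * (p * s ^ 2 - E ^ 2) ^ 2
      = s ^ 2 * ((p * s * c) ^ 2 - (E * (E + 2 * P)) ^ 2)
        + E ^ 2 * ((E + 2 * P * s ^ 2) ^ 2 + 2 * p * s ^ 2 * c ^ 2) := by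
    have hc2 : c ^ 2 = 1 - s ^ 2 := by linarith
    rw [mul_pow (p * s), hc2, ← hP]
    ring
  have hs2 : 0 < s ^ 2 := by positivity
  have hlt := mul_lt_mul_of_pos_left (lt_sub_iff_add_lt.2 h) hs2
  rw [hid]
  nlinarith

/-- A point of the visual angle ball lies in the outer ball, by squaring its inequality; the mixed
term of the square is handled by the bound `c t ≤ s (p + q)`, which the inequality implies. -/
lemma sq_lt_of_planar {p q t c s : ℝ} (hp : 0 < p) (hq : 0 < q) (ht : 0 ≤ t) (hc : 0 < c)
    (hs : 0 < s) (hcs : c ^ 2 + s ^ 2 = 1) (h : (p + q) * c + t * s < 2 * √(p * q)) :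
    c ^ 2 * (t ^ 2 + (p + q) ^ 2) < 4 * (p * q) := by
  have hm := Real.sq_sqrt (mul_pos hp hq).le
  have hpq : 2 * √(p * q) ≤ p + q := by
    refine (abs_le_of_sq_le_sq' ?_ (by positivity)).2
    nlinarith [sq_nonneg (p - q)]
  have hc1 : c < 1 := by nlinarith
  -- The steepness bound `c t ≤ s (p + q)`.
  have h1 : c * t ≤ s * (p + q) := by
    refine le_of_mul_le_mul_left ?_ hs
    have : c * (s * t) ≤ c * ((p + q) * (1 - c)) :=
      mul_le_mul_of_nonneg_left (by linarith) hc.le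
    nlinarith [mul_pos (add_pos hp hq) (sub_pos.2 hc1)]
  have h2 : ((p + q) * c + t * s) ^ 2 < (2 * √(p * q)) ^ 2 := by gcongr
  have h3 : 0 ≤ c * t * (s * (p + q) - c * t) := by
    have := sub_nonneg.2 h1; positivity
  have h4 : 0 ≤ t * s * (c * (p + q) + s * t) := by positivity
  nlinarith

/-- On the vertical line through `x`, where `t = 0`, the outer ball and the visual angle ball
agree. -/
lemma planar_of_sq_lt {p q c : ℝ} (hp : 0 < p) (h : c ^ 2 * (p + q) ^ 2 < 4 * (p * q)) :
    0 < q ∧ (p + q) * c < 2 * √(p * q) := by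
  have hpq : 0 < p * q := by nlinarith [sq_nonneg (c * (p + q))]
  refine ⟨pos_of_mul_pos_right hpq hp.le, (abs_lt_of_sq_lt_sq' ?_ (by positivity)).2⟩
  rw [mul_pow, mul_pow, Real.sq_sqrt hpq.le]
  linarith

/-- A point of the ball of radius `p sin r` around `x` lies in the visual angle ball. Here
`r = π / 2` is included, that is, `c = 0` is allowed. -/
lemma planar_of_mem_centered {p q t c s : ℝ} (hp : 0 < p) (hs : 0 < s) (hs1 : s ≤ 1)
    (hcs : c ^ 2 + s ^ 2 = 1) (h : t ^ 2 + (q - p) ^ 2 < (p * s) ^ 2) :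
    0 < q ∧ (p + q) * c + t * s < 2 * √(p * q) := by
  have hq : 0 < q := by
    have h2 := (abs_lt_of_sq_lt_sq' (a := q - p) (b := p * s) (by nlinarith) (by positivity)).1
    nlinarith
  refine ⟨hq, ?_⟩
  obtain ⟨D, hD0, hD⟩ : ∃ D, 0 ≤ D ∧ D ^ 2 = t ^ 2 + (q - p) ^ 2 :=
    ⟨_, Real.sqrt_nonneg _, Real.sq_sqrt (by positivity)⟩
  have hDp : D < p * s := by
    refine lt_of_pow_lt_pow_left₀ 2 (by positivity) ?_
    linarith
  -- By the Cauchy-Schwarz inequality for `(c, -s)` and `(t, q - p)`.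
  have hcs' : c * t - s * (q - p) ≤ D := by
    refine (abs_le_of_sq_le_sq' ?_ hD0).2
    nlinarith [sq_nonneg (c * (q - p) + s * t)]
  have h1 : D < s * (p + q) - c * t := by nlinarith
  have h2 : D ^ 2 < (s * (p + q) - c * t) ^ 2 := by gcongr
  refine (abs_lt_of_sq_lt_sq' ?_ (by positivity)).2
  rw [mul_pow 2, Real.sq_sqrt (mul_pos hp hq).le]
  have hid : ((p + q) * c + t * s) ^ 2 + (s * (p + q) - c * t) ^ 2 = (p + q) ^ 2 + t ^ 2 := by
    linear_combination ((p + q) ^ 2 + t ^ 2) * hcs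
  nlinarith

lemma le_of_forall_lt_of_sq {A B M ρ : ℝ} (hρ : 0 < ρ)
    (h : ∀ σ, 0 ≤ σ → σ < ρ → A + B * σ ^ 2 ≤ M) : A + B * ρ ^ 2 ≤ M := by
  have hcont : Continuous fun σ : ℝ => A + B * σ ^ 2 := by fun_prop
  refine le_of_tendsto ((hcont.tendsto ρ).mono_left (nhdsWithin_le_nhds (s := Set.Iio ρ))) ?_
  filter_upwards [self_mem_nhdsWithin, nhdsWithin_le_nhds (lt_mem_nhds hρ)] with σ h1 h2
  exact h σ (le_of_lt h2) h1

/-! ### The two centres in coordinates -/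

lemma eq_of_horizontalPart_sub_eq_zero {y c : EuclideanSpace ℝ (Fin (d + 1))}
    (h : horizontalPart (y - c) = 0) (hl : y (Fin.last d) = c (Fin.last d)) : y = c := by
  have := norm_sq_eq_horizontalPart (y - c)
  rw [h, PiLp.sub_apply, hl] at this
  simpa [sub_eq_zero] using this

lemma innerCenter_last (x : EuclideanSpace ℝ (Fin (d + 1))) (r : ℝ) :
    innerCenter x r (Fin.last d) = x (Fin.last d) / cos r ^ 2 := by
  simp only [innerCenter, PiLp.add_apply, PiLp.smul_apply, lastUnitVec_last, smul_eq_mul]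
  ring

lemma outerCenter_last (x : EuclideanSpace ℝ (Fin (d + 1))) (r : ℝ) :
    outerCenter x r (Fin.last d) = x (Fin.last d) + 2 * x (Fin.last d) * tan r ^ 2 := by
  simp [outerCenter]

lemma horizontalPart_sub_innerCenter (x y : EuclideanSpace ℝ (Fin (d + 1))) (r : ℝ) :
    horizontalPart (y - innerCenter x r) = horizontalPart (y - x) := by
  simp [innerCenter, horizontalPart_sub, horizontalPart_add, horizontalPart_smul]

lemma horizontalPart_sub_outerCenter (x y : EuclideanSpace ℝ (Fin (d + 1))) (r : ℝ) :
    horizontalPart (y - outerCenter x r) = horizontalPart (y - x) := by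
  simp [outerCenter, horizontalPart_sub, horizontalPart_add, horizontalPart_smul]

/-- The outer ball is, in coordinates, the hyperbolic ball `t² + (p + q)² < 4 p q / cos² r`. -/
lemma outer_identity {p q t r : ℝ} (hc : cos r ≠ 0) :
    cos r ^ 2 * (t ^ 2 + (q - (p + 2 * p * tan r ^ 2)) ^ 2 - (2 * p * (tan r / cos r)) ^ 2)
      = cos r ^ 2 * (t ^ 2 + (p + q) ^ 2) - 4 * (p * q) := by
  have hs : sin r ^ 2 = 1 - cos r ^ 2 := by rw [← sin_sq_add_cos_sq r]; ring
  rw [tan_eq_sin_div_cos]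
  field_simp
  rw [hs]
  ring

/-! ### Inclusions and optimality -/

section

variable {x : EuclideanSpace ℝ (Fin (d + 1))} {r : ℝ}

lemma ball_innerCenter_subset (hd : 1 ≤ d) (hx : 0 < x (Fin.last d)) (hr : 0 < r)
    (hr2 : r < π / 2) :
    Metric.ball (innerCenter x r) (tan r * x (Fin.last d)) ⊆
      visualAngleBall (upperHalfSpace d) x r := by
  intro y hy
  have hc := cos_pos_of_mem_Ioo ⟨by linarith, hr2⟩
  have ht := tan_pos_of_pos_of_lt_pi_div_two hr hr2
  rw [mem_ball_iff_horizontalPart (by positivity), horizontalPart_sub_innerCenter,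
    innerCenter_last] at hy
  rw [mem_visualAngleBall_iff hd hx hr (by linarith)]
  refine planar_of_mem_inner hx hc (sin_pos_of_pos_of_lt_pi hr (by linarith))
    (cos_sq_add_sin_sq r) ?_
  rw [tan_eq_sin_div_cos] at hy
  have h := mul_lt_mul_of_pos_left hy (pow_pos hc 4)
  have h1 : cos r ^ 4 * (‖horizontalPart (y - x)‖ ^ 2
        + (y (Fin.last d) - x (Fin.last d) / cos r ^ 2) ^ 2)
      = cos r ^ 4 * ‖horizontalPart (y - x)‖ ^ 2
        + (cos r ^ 2 * y (Fin.last d) - x (Fin.last d)) ^ 2 := by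
    field_simp
  have h2 : cos r ^ 4 * (sin r / cos r * x (Fin.last d)) ^ 2
      = (x (Fin.last d) * sin r * cos r) ^ 2 := by
    field_simp
  rwa [h1, h2] at h

lemma visualAngleBall_subset_ball_outerCenter (hd : 1 ≤ d) (hx : 0 < x (Fin.last d)) (hr : 0 < r)
    (hr2 : r < π / 2) :
    visualAngleBall (upperHalfSpace d) x r ⊆
      Metric.ball (outerCenter x r) (2 * x (Fin.last d) * (tan r / cos r)) := by
  intro y hy
  have hc := cos_pos_of_mem_Ioo ⟨by linarith, hr2⟩
  have ht := tan_pos_of_pos_of_lt_pi_div_two hr hr2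
  rw [mem_visualAngleBall_iff hd hx hr (by linarith)] at hy
  rw [mem_ball_iff_horizontalPart (by positivity), horizontalPart_sub_outerCenter,
    outerCenter_last]
  have h := sq_lt_of_planar hx hy.1 (norm_nonneg _) hc (sin_pos_of_pos_of_lt_pi hr (by linarith))
    (cos_sq_add_sin_sq r) hy.2
  rw [← sub_neg, ← outer_identity hc.ne'] at h
  exact sub_neg.1 (neg_of_mul_neg_right h (by positivity))

lemma ball_self_subset (hd : 1 ≤ d) (hx : 0 < x (Fin.last d)) (hr : 0 < r) (hr2 : r ≤ π / 2) :
    Metric.ball x (x (Fin.last d) * sin r) ⊆ visualAngleBall (upperHalfSpace d) x r := by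
  intro y hy
  have hs := sin_pos_of_pos_of_lt_pi hr (by linarith [pi_pos])
  rw [mem_ball_iff_horizontalPart (by positivity)] at hy
  rw [mem_visualAngleBall_iff hd hx hr (by linarith [pi_pos])]
  exact planar_of_mem_centered hx hs (sin_le_one r) (cos_sq_add_sin_sq r) hy

/-- Moving the centre of a ball inside `B_v(x, r)` by almost its radius in two opposite horizontal
directions stays within the horizontal extent `xₙ tan r` of `B_v(x, r)`, which is approached
only at the height of `innerCenter x r`. -/
lemma innerBall_optimal (hd : 1 ≤ d) (hx : 0 < x (Fin.last d)) (hr : 0 < r) (hr2 : r < π / 2)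
    {c : EuclideanSpace ℝ (Fin (d + 1))} {ρ : ℝ}
    (h : Metric.ball c ρ ⊆ visualAngleBall (upperHalfSpace d) x r) :
    ρ ≤ tan r * x (Fin.last d) ∧ (ρ = tan r * x (Fin.last d) → c = innerCenter x r) := by
  have hc := cos_pos_of_mem_Ioo ⟨by linarith, hr2⟩
  have hs := sin_pos_of_pos_of_lt_pi hr (by linarith)
  have hcs := cos_sq_add_sin_sq r
  have ht := tan_pos_of_pos_of_lt_pi_div_two hr hr2
  have hR : 0 < tan r * x (Fin.last d) := by positivity
  rcases le_or_gt ρ 0 with hρ | hρ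
  · exact ⟨by linarith, fun h => by linarith⟩
  obtain ⟨e, he, he0⟩ := exists_unit_horizontal hd
  have hmem : ∀ a : ℝ, |a| < ρ → cos r * sin r * ‖horizontalPart (c - x) + a • e‖
      < x (Fin.last d) * sin r ^ 2 - (cos r * √(c (Fin.last d)) - √(x (Fin.last d))) ^ 2 := by
    intro a ha
    have hy : c + a • e ∈ Metric.ball c ρ := by
      rw [mem_ball_iff_norm]; simpa [norm_smul, he] using ha
    have hy := (mem_visualAngleBall_iff hd hx hr (by linarith)).1 (h hy)
    have hl : (c + a • e) (Fin.last d) = c (Fin.last d) := by simp [he0]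
    have hw : horizontalPart (c + a • e - x) = horizontalPart (c - x) + a • e := by
      rw [add_sub_right_comm, horizontalPart_add, horizontalPart_smul,
        horizontalPart_of_last_eq_zero he0]
    rw [hl, hw] at hy
    exact (planar_iff hx hy.1 hc hcs).1 hy.2
  have hk : 0 < c (Fin.last d) := (h (Metric.mem_ball_self hρ)).1
  set w := horizontalPart (c - x)
  set p := x (Fin.last d)
  obtain ⟨E, hE⟩ : ∃ E, E = cos r * √(c (Fin.last d)) - √p := ⟨_, rfl⟩
  rw [← hE] at hmem
  have hN : 0 ≤ p * sin r ^ 2 - E ^ 2 := by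
    refine le_trans ?_ (hmem 0 (by simpa using hρ)).le
    positivity
  have hlim : (cos r * sin r) ^ 2 * ‖w‖ ^ 2 + (cos r * sin r) ^ 2 * ρ ^ 2
      ≤ (p * sin r ^ 2 - E ^ 2) ^ 2 := by
    refine le_of_forall_lt_of_sq hρ fun σ hσ hσρ => ?_
    have h1 := hmem σ (by rwa [abs_of_nonneg hσ])
    have h2 := hmem (-σ) (by rwa [abs_neg, abs_of_nonneg hσ])
    have hpar := parallelogram_law_with_norm ℝ w (σ • e)
    rw [neg_smul, ← sub_eq_add_neg] at h2
    rw [norm_smul, he, mul_one, Real.norm_eq_abs, sq_abs] at hpar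
    have h3 := pow_le_pow_left₀ (by positivity) h1.le 2
    have h4 := pow_le_pow_left₀ (by positivity) h2.le 2
    rw [mul_pow] at h3 h4
    have h5 : (cos r * sin r) ^ 2 * (‖w + σ • e‖ ^ 2 + ‖w - σ • e‖ ^ 2)
      = (cos r * sin r) ^ 2 * (2 * (‖w‖ ^ 2 + σ ^ 2)) := by
      rw [hpar]
    linarith
  have hlin : cos r * sin r * ρ ≤ p * sin r ^ 2 - E ^ 2 := by
    refine (abs_le_of_sq_le_sq' ?_ hN).2
    rw [mul_pow]
    exact le_trans (le_add_of_nonneg_left (by positivity)) hlim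
  have hT : cos r * sin r * (tan r * p) = p * sin r ^ 2 := by
    rw [tan_eq_sin_div_cos]; field_simp
  constructor
  · refine le_of_mul_le_mul_left ?_ (mul_pos hc hs)
    rw [hT]
    linarith [sq_nonneg E]
  · intro hρe
    have hE0 : E = 0 := by
      rw [hρe, hT] at hlin
      exact pow_eq_zero_iff two_ne_zero |>.1 (le_antisymm (by linarith) (sq_nonneg E))
    have hw0 : w = 0 := by
      rw [← mul_pow _ ρ, hρe, hT, hE0] at hlim
      have h1 : (cos r * sin r) ^ 2 * ‖w‖ ^ 2 ≤ 0 := by nlinarith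
      have h2 : ‖w‖ ^ 2 ≤ 0 := nonpos_of_mul_nonpos_right h1 (by positivity)
      exact norm_eq_zero.1 (pow_eq_zero_iff two_ne_zero |>.1 (le_antisymm h2 (sq_nonneg _)))
    refine eq_of_horizontalPart_sub_eq_zero (by rw [horizontalPart_sub_innerCenter]; exact hw0) ?_
    rw [innerCenter_last, eq_div_iff (by positivity)]
    have h1 : cos r * √(c (Fin.last d)) = √p := by linarith
    have h2 := congrArg (· ^ 2) h1
    simp only [mul_pow, Real.sq_sqrt hk.le, Real.sq_sqrt hx.le] at h2
    linarith

/-- The open vertical diameter of the outer ball lies in `B_v(x, r)`, and a ball containing it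
has at least half its length as radius, with equality only if it is centred at the midpoint. -/
lemma outerBall_optimal (hd : 1 ≤ d) (hx : 0 < x (Fin.last d)) (hr : 0 < r) (hr2 : r < π / 2)
    {c : EuclideanSpace ℝ (Fin (d + 1))} {ρ : ℝ}
    (h : visualAngleBall (upperHalfSpace d) x r ⊆ Metric.ball c ρ) :
    2 * x (Fin.last d) * (tan r / cos r) ≤ ρ ∧
      (ρ = 2 * x (Fin.last d) * (tan r / cos r) → c = outerCenter x r) := by
  have hc := cos_pos_of_mem_Ioo ⟨by linarith, hr2⟩
  have ht := tan_pos_of_pos_of_lt_pi_div_two hr hr2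
  have hR : 0 < 2 * x (Fin.last d) * (tan r / cos r) := by positivity
  have hmem : ∀ a : ℝ, |a| < 2 * x (Fin.last d) * (tan r / cos r) →
      ‖outerCenter x r - c + a • lastUnitVec d‖ < ρ := by
    intro a ha
    have hy : outerCenter x r + a • lastUnitVec d ∈ visualAngleBall (upperHalfSpace d) x r := by
      rw [mem_visualAngleBall_iff hd hx hr (by linarith)]
      have hw : horizontalPart (outerCenter x r + a • lastUnitVec d - x) = 0 := by
        simp [outerCenter, horizontalPart_sub, horizontalPart_add, horizontalPart_smul]
      have hl : (outerCenter x r + a • lastUnitVec d) (Fin.last d)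
          = x (Fin.last d) + 2 * x (Fin.last d) * tan r ^ 2 + a := by
        simp [outerCenter]
      rw [hw, hl, norm_zero, zero_mul, add_zero]
      refine planar_of_sq_lt hx ?_
      have hid := outer_identity (p := x (Fin.last d)) (t := 0)
        (q := x (Fin.last d) + 2 * x (Fin.last d) * tan r ^ 2 + a) hc.ne'
      have hneg : cos r ^ 2 * (a ^ 2 - (2 * x (Fin.last d) * (tan r / cos r)) ^ 2) < 0 :=
        mul_neg_of_pos_of_neg (by positivity)
          (sub_neg.2 (sq_lt_sq' (abs_lt.1 ha).1 (abs_lt.1 ha).2))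
      rw [add_sub_cancel_left] at hid
      linarith
    have := h hy
    rwa [mem_ball_iff_norm, add_sub_right_comm] at this
  set R := 2 * x (Fin.last d) * (tan r / cos r)
  have hρ : 0 < ρ := (norm_nonneg _).trans_lt (hmem 0 (by simpa using hR))
  have hlim : ‖outerCenter x r - c‖ ^ 2 + 1 * R ^ 2 ≤ ρ ^ 2 := by
    refine le_of_forall_lt_of_sq hR fun σ hσ hσR => ?_
    have h1 := hmem σ (by rwa [abs_of_nonneg hσ])
    have h2 := hmem (-σ) (by rwa [abs_neg, abs_of_nonneg hσ])
    have hpar := parallelogram_law_with_norm ℝ (outerCenter x r - c) (σ • lastUnitVec d)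
    rw [neg_smul, ← sub_eq_add_neg] at h2
    rw [norm_smul, norm_lastUnitVec, mul_one, Real.norm_eq_abs, sq_abs] at hpar
    have h3 := pow_le_pow_left₀ (by positivity) h1.le 2
    have h4 := pow_le_pow_left₀ (by positivity) h2.le 2
    linarith
  constructor
  · refine (abs_le_of_sq_le_sq' ?_ hρ.le).2
    linarith [sq_nonneg ‖outerCenter x r - c‖]
  · intro hρR
    rw [hρR] at hlim
    have h0 : ‖outerCenter x r - c‖ ^ 2 = 0 :=
      le_antisymm (by linarith) (sq_nonneg _)
    exact (sub_eq_zero.1 (norm_eq_zero.1 (pow_eq_zero_iff two_ne_zero |>.1 h0))).symm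

lemma visualAngleBall_subset_ball_self (hd : 1 ≤ d) (hx : 0 < x (Fin.last d)) (hr : 0 < r)
    (hr2 : r < π / 2) :
    visualAngleBall (upperHalfSpace d) x r ⊆
      Metric.ball x (2 * x (Fin.last d) * (tan r / cos r + tan r ^ 2)) := by
  refine (visualAngleBall_subset_ball_outerCenter hd hx hr hr2).trans (Metric.ball_subset_ball' ?_)
  have h : dist (outerCenter x r) x = 2 * x (Fin.last d) * tan r ^ 2 := by
    rw [outerCenter, dist_eq_norm, add_sub_cancel_left, norm_smul, norm_lastUnitVec, mul_one,
      Real.norm_of_nonneg (by positivity)]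
  rw [h]
  exact le_of_eq (by ring)

end

theorem theorem1p3 (d : ℕ) (hd : 1 ≤ d) (x : EuclideanSpace ℝ (Fin (d + 1)))
    (hx : x ∈ upperHalfSpace d) :
    (∀ r : ℝ, 0 < r → r < Real.pi / 2 →
      -- the two inclusions
      Metric.ball (innerCenter x r) (Real.tan r * x (Fin.last d)) ⊆
          visualAngleBall (upperHalfSpace d) x r ∧
      visualAngleBall (upperHalfSpace d) x r ⊆
          Metric.ball (outerCenter x r) (2 * x (Fin.last d) * (Real.tan r / Real.cos r)) ∧
      -- the inner ball is the unique largest Euclidean ball contained in the visual angle ball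
      (∀ (c : EuclideanSpace ℝ (Fin (d + 1))) (ρ : ℝ),
        Metric.ball c ρ ⊆ visualAngleBall (upperHalfSpace d) x r →
          ρ ≤ Real.tan r * x (Fin.last d) ∧
          (ρ = Real.tan r * x (Fin.last d) → c = innerCenter x r)) ∧
      -- the outer ball is the unique smallest Euclidean ball containing the visual angle ball
      (∀ (c : EuclideanSpace ℝ (Fin (d + 1))) (ρ : ℝ),
        visualAngleBall (upperHalfSpace d) x r ⊆ Metric.ball c ρ →
          2 * x (Fin.last d) * (Real.tan r / Real.cos r) ≤ ρ ∧
          (ρ = 2 * x (Fin.last d) * (Real.tan r / Real.cos r) → c = outerCenter x r)) ∧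
      -- the outer inclusion for a ball centred at `x`
      visualAngleBall (upperHalfSpace d) x r ⊆
          Metric.ball x
            (2 * x (Fin.last d) * (Real.tan r / Real.cos r + Real.tan r ^ 2))) ∧
    -- the inner inclusion for a ball centred at `x`, which makes sense for `r = π / 2` too
    (∀ r : ℝ, 0 < r → r ≤ Real.pi / 2 →
      Metric.ball x (x (Fin.last d) * Real.sin r) ⊆
          visualAngleBall (upperHalfSpace d) x r) := by
  exact ⟨fun r hr hr2 => ⟨ball_innerCenter_subset hd hx hr hr2,
    visualAngleBall_subset_ball_outerCenter hd hx hr hr2,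
    fun _ _ h => innerBall_optimal hd hx hr hr2 h, fun _ _ h => outerBall_optimal hd hx hr hr2 h,
    visualAngleBall_subset_ball_self hd hx hr hr2⟩,
    fun r hr hr2 => ball_self_subset hd hx hr hr2⟩
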